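/- Let $K$ be a field and let $q\in K$ be nonzero and not a root of unity (for example, $K=\mathbb{Q}(q)$ with $q$ an indeterminate). For integers $n,k\ge 0$ and $A,p\in K$ put $$(A;p)_n=\prod_{i=0}^{n-1}(1-Ap^i),$$ and, for $p\in K$ nonzero and not a root of unity, $$\begin{bmatrix} n\\ k\end{bmatrix}_p=\frac{(p^n;p^{-1})_k}{(p;p)_k},\qquad \begin{bmatrix} n\\ -1\end{bmatrix}_p=0 .$$ For $0\le k\le n-1$ put $$og_{k,2n}(q)=\frac{(q^{4(n-k)};q^4)_k}{(q^2;q^2)_k}\cdot\frac{1-q^{2n}}{1-q^{2(n-k)}} .$$ For $n\ge 1$ let $h_0^{(n)}(q),\dots,h_{n-1}^{(n)}(q)$ be defined recursively by the $n$ equations $$og_{k,2n}(q)=\sum_{j=0}^{k}q^{(k-j)(k-j+1)}\,h_j^{(n)}(q)\begin{bmatrix} 2n-1-k-j\\ k-j\end{bmatrix}_{q^2},\qquad 0\le k\le n-1 .$$ Then for all $0\le m\le n-1$, $$h_m^{(n)}(q)=\sum_{k=0}^{\lfloor m/2\rfloor}(-q^{2n-2};q^{-2})_{m-2k}\begin{bmatrix}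 n-m+2k\\ k\end{bmatrix}_{q^4}\frac{1-q^{4(n-m)}}{1-q^{4(n-m+2k)}}\,q^{4k}$$ $$\phantom{h_m^{(n)}(q)}=\sum_{k=0}^{\lfloor m/2\rfloor}(-q^{2n-2};q^{-2})_{m-2k}\left(\begin{bmatrix} n-m+2k-1\\ k\end{bmatrix}_{q^4}-\begin{bmatrix} n-m+2k-1\\ k-1\end{bmatrix}_{q^4}\right).$$ -/

import Mathlib

open Finset

namespace OrthGrass

noncomputable section

/-- The `q`-shifted factorial `(A; q)_n = ∏_{i=0}^{n-1} (1 - A q^i)`. -/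
def qPoch {K : Type*} [Field K] (A q : K) (n : ℕ) : K :=
  ∏ i ∈ range n, (1 - A * q ^ i)

/-- The `q`-binomial coefficient `[n choose k]_q = (q^n; q⁻¹)_k / (q; q)_k` for `k ≥ 0`, with the
convention that it is `0` for a negative lower index `k`. -/
def qBinom {K : Type*} [Field K] (q : K) (n : ℕ) : ℤ → K
  | Int.ofNat k => qPoch (q ^ n) q⁻¹ k / qPoch q q k
  | Int.negSucc _ => 0

/-- `og_{k,2n}(q) = (q^{4(n-k)}; q^4)_k / (q^2; q^2)_k * (1 - q^{2n}) / (1 - q^{2(n-k)})`,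
meant for `0 ≤ k ≤ n - 1`. -/
def og {K : Type*} [Field K] (q : K) (n k : ℕ) : K :=
  qPoch (q ^ (4 * (n - k))) (q ^ 4) k / qPoch (q ^ 2) (q ^ 2) k *
    ((1 - q ^ (2 * n)) / (1 - q ^ (2 * (n - k))))

/-- The element `h_k^{(n)}(q)`, meant for `0 ≤ k ≤ n - 1`: the `k`-th equation
`og_{k,2n}(q) = ∑_{j=0}^k q^{(k-j)(k-j+1)} h_j^{(n)}(q) [2n-1-k-j choose k-j]_{q^2}`,
in which `h_k^{(n)}(q)` has coefficient `1`, solved for `h_k^{(n)}(q)`.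
See `og_eq_sum_h` and `eq_h_of_og_eq_sum`. -/
def h {K : Type*} [Field K] (q : K) (n k : ℕ) : K :=
  og q n k - ∑ j : Fin k, q ^ ((k - j.1) * (k - j.1 + 1)) * h q n j.1 *
    qBinom (q ^ 2) (2 * n - 1 - k - j.1) ((k : ℤ) - (j.1 : ℤ))
termination_by k
decreasing_by exact j.2

theorem qBinom_zero {K : Type*} [Field K] (q : K) (n : ℕ) : qBinom q n 0 = 1 := by
  change qPoch (q ^ n) q⁻¹ 0 / qPoch q q 0 = 1
  simp [qPoch]

/-- The elements `h_j^{(n)}(q)` satisfy their defining equations. -/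
theorem og_eq_sum_h {K : Type*} [Field K] (q : K) (n k : ℕ) :
    og q n k = ∑ j ∈ range (k + 1), q ^ ((k - j) * (k - j + 1)) * h q n j *
      qBinom (q ^ 2) (2 * n - 1 - k - j) ((k : ℤ) - (j : ℤ)) := by
  rw [sum_range_succ, ← Fin.sum_univ_eq_sum_range (fun j => q ^ ((k - j) * (k - j + 1)) *
    h q n j * qBinom (q ^ 2) (2 * n - 1 - k - j) ((k : ℤ) - (j : ℤ))) k]
  conv_rhs => enter [2]; rw [h]
  simp [qBinom_zero]

/-- The `n` defining equations determine `h_0^{(n)}(q), …, h_{n-1}^{(n)}(q)`. -/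
theorem eq_h_of_og_eq_sum {K : Type*} [Field K] (q : K) (n : ℕ) (g : ℕ → K)
    (hg : ∀ k < n, og q n k = ∑ j ∈ range (k + 1), q ^ ((k - j) * (k - j + 1)) * g j *
      qBinom (q ^ 2) (2 * n - 1 - k - j) ((k : ℤ) - (j : ℤ))) :
    ∀ k < n, g k = h q n k := by
  intro k
  induction k using Nat.strong_induction_on with
  | _ k ih =>
    intro hk
    have h1 := hg k hk
    rw [og_eq_sum_h, sum_range_succ, sum_range_succ] at h1
    have h2 : ∀ j ∈ range k, q ^ ((k - j) * (k - j + 1)) * h q n j *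
        qBinom (q ^ 2) (2 * n - 1 - k - j) ((k : ℤ) - (j : ℤ)) =
        q ^ ((k - j) * (k - j + 1)) * g j *
        qBinom (q ^ 2) (2 * n - 1 - k - j) ((k : ℤ) - (j : ℤ)) := by
      intro j hj
      rw [mem_range] at hj
      rw [ih j hj (hj.trans hk)]
    rw [sum_congr rfl h2] at h1
    simpa [qBinom_zero] using h1.symm

end

end OrthGrass

/-!
Put `p = q ^ 2`. By `eq_h_of_og_eq_sum` it suffices that the proposed values of `h` solve the
defining equations. Substituting them into the `k`-th equation and collecting the terms with a fixed
factor `(-p ^ (n - 1); p⁻¹)_s`, the coefficient of that factor depends only on `M = n - k` and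
`r = k - s`, and it has a closed form:

`∑_{ℓ + 2 i = r} p ^ (ℓ (ℓ + 1) / 2) B(M + ℓ, i) [2 M - 1 + ℓ choose ℓ]_p`
`  = p ^ r (p ^ (2 M); p ^ 2)_r / (p; p)_r`,

where `B(D, i) = [D + 2 i choose i] (1 - P ^ D) / (1 - P ^ (D + 2 i)) P ^ i` with `P = p ^ 2`. After
division by `p ^ r (a; p ^ 2)_r`, where `a = p ^ (2 M)`, this is an identity in `a` (`sum_term`). It
is proved by creative telescoping in steps of two in `r`, with the certificate `cert`
(`term_telescope`).

What remains is the indefinite sum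
`∑_{r ≤ k} p ^ r (A; p)_r / (p; p)_r = (A p; p)_k / (p; p)_k` at `A = p ^ (n - k)`
(`sum_qPoch_div`), because `(A ^ 2; p ^ 2)_r = (A; p)_r (-A; p)_r`, and `(-A; p)_r` joins with
`(-p ^ (n - 1); p⁻¹)_s` to the factor `(-A; p)_k`, which is independent of `s`.
-/

namespace OrthGrass

variable {K : Type*} [Field K]

/-! ### Shifted factorials and `q`-binomial coefficients -/

theorem qPoch_zero (A q : K) : qPoch A q 0 = 1 := by simp [qPoch]

theorem qPoch_succ (A q : K) (n : ℕ) : qPoch A q (n + 1) = qPoch A q n * (1 - A * q ^ n) := by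
  simp [qPoch, prod_range_succ]

theorem qPoch_add (A q : K) (m n : ℕ) :
    qPoch A q (m + n) = qPoch A q m * qPoch (A * q ^ m) q n := by
  simp [qPoch, prod_range_add, pow_add, mul_assoc]

theorem qPoch_succ_left (A q : K) (n : ℕ) :
    qPoch A q (n + 1) = (1 - A) * qPoch (A * q) q n := by
  rw [add_comm, qPoch_add]
  simp [qPoch]

theorem qPoch_sq (A q : K) (n : ℕ) :
    qPoch (A ^ 2) (q ^ 2) n = qPoch A q n * qPoch (-A) q n := by
  rw [qPoch, qPoch, qPoch, ← prod_mul_distrib]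
  refine prod_congr rfl fun i _ => ?_
  ring

/-- Reversing the order of the factors turns the base `q⁻¹` into the base `q`. -/
theorem qPoch_inv (c : K) {q : K} (hq : q ≠ 0) (N k : ℕ) :
    qPoch (c * q ^ (N + k)) q⁻¹ k = qPoch (c * q ^ (N + 1)) q k := by
  rw [qPoch, qPoch, ← prod_range_reflect]
  refine prod_congr rfl fun i hi => ?_
  obtain ⟨j, rfl⟩ := Nat.exists_eq_add_of_lt (mem_range.1 hi)
  have h1 : i + j + 1 - 1 - i = j := by omega
  rw [h1, inv_pow]
  have : q ^ j ≠ 0 := pow_ne_zero _ hq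
  field_simp
  ring

theorem qPoch_pow_ne_zero {p : K} (hp : ∀ i : ℕ, 0 < i → p ^ i ≠ 1) {s : ℕ} (hs : 0 < s)
    (t n : ℕ) : qPoch (p ^ s) (p ^ t) n ≠ 0 := by
  rw [qPoch, prod_ne_zero_iff]
  intro i _
  rw [← pow_mul, ← pow_add, sub_ne_zero]
  exact (hp _ (by omega)).symm

theorem qPoch_self_ne_zero {p : K} (hp : ∀ i : ℕ, 0 < i → p ^ i ≠ 1) (n : ℕ) :
    qPoch p p n ≠ 0 := by
  simpa using qPoch_pow_ne_zero hp one_pos 1 n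

theorem qBinom_add {p : K} (hp0 : p ≠ 0) (N k : ℕ) :
    qBinom p (N + k) (k : ℤ) = qPoch (p ^ (N + 1)) p k / qPoch p p k := by
  change qPoch (p ^ (N + k)) p⁻¹ k / qPoch p p k = _
  simpa using congrArg (· / qPoch p p k) (qPoch_inv 1 hp0 N k)

/-- The indefinite `q`-binomial sum. -/
theorem sum_qPoch_div {p : K} (hp : ∀ i : ℕ, 0 < i → p ^ i ≠ 1) (A : K) (k : ℕ) :
    ∑ r ∈ range (k + 1), p ^ r * qPoch A p r / qPoch p p r =
      qPoch (A * p) p k / qPoch p p k := by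
  induction k with
  | zero => simp [qPoch_zero]
  | succ k ih =>
    have h1 := qPoch_self_ne_zero hp k
    have h2 : (1 : K) - p * p ^ k ≠ 0 := by
      rw [← pow_succ', sub_ne_zero]
      exact (hp _ k.succ_pos).symm
    rw [sum_range_succ, ih, qPoch_succ_left A, qPoch_succ p, qPoch_succ (A * p)]
    field_simp
    ring

/-! ### The telescoping identity -/

/-- The summand with `r = ℓ + 2 i` of the coefficient sum, normalized so that the sum over all
`ℓ + 2 i = r` is `1 / (p; p)_r`. -/
def term (p a : K) (l i : ℕ) : K :=
  p ^ (l.choose 2) * qPoch a p l * (1 - a * p ^ (2 * l)) /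
    (qPoch p p l * qPoch (p ^ 2) (p ^ 2) i * qPoch a (p ^ 2) (l + i + 1))

/-- The telescoping certificate for `term`. The truncation of `l - 1` at `l = 0` is harmless, since
then `1 - p ^ l = 0`. -/
def cert (p a : K) (l i : ℕ) : K :=
  p ^ (2 * i) * p ^ (l.choose 2) * qPoch a p l * (1 - p ^ l) * (1 - p ^ (l - 1)) /
    (qPoch p p l * qPoch (p ^ 2) (p ^ 2) i * qPoch a (p ^ 2) (l + i))

theorem cert_of_lt_two (p a : K) {l : ℕ} (hl : l < 2) (i : ℕ) : cert p a l i = 0 := by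
  interval_cases l <;> simp [cert]

theorem term_zero {p a : K} (ha : ∀ n, qPoch a (p ^ 2) n ≠ 0) (r : ℕ) :
    (1 - p ^ r) * (1 - p ^ (r - 1)) * term p a r 0 = cert p a r 0 := by
  have h1 := ha (r + 1)
  rw [qPoch_succ] at h1
  have h2 := left_ne_zero_of_mul h1
  have h3 := right_ne_zero_of_mul h1
  simp only [term, cert, qPoch_zero, add_zero, qPoch_succ, mul_zero, pow_zero, one_mul, mul_one]
  rw [← pow_mul] at h3 ⊢
  rw [← mul_assoc, mul_div_mul_right _ _ h3]
  ring

theorem choose_add_two (l : ℕ) : (l + 2).choose 2 = l.choose 2 + (2 * l + 1) := by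
  rw [Nat.choose_succ_succ' (l + 1) 1, Nat.choose_succ_succ' l 1]
  simp
  omega

theorem term_telescope {p a : K} (hp0 : p ≠ 0) (hp : ∀ i : ℕ, 0 < i → p ^ i ≠ 1)
    (ha : ∀ n, qPoch a (p ^ 2) n ≠ 0) (l i : ℕ) :
    (1 - p ^ (l + 2 * i + 2)) * (1 - p ^ (l + 2 * i + 1)) * term p a l (i + 1) - term p a l i =
      cert p a l (i + 1) - cert p a (l + 2) i := by
  have hl := qPoch_self_ne_zero hp (l + 2)
  have hi := qPoch_pow_ne_zero hp two_pos 2 (i + 1)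
  have hA := ha (l + i + 2)
  -- the factor `1 - p ^ (l - 1)` is written without truncated subtraction
  have hc : cert p a l (i + 1) = p ^ (2 * (i + 1)) * p ^ (l.choose 2) * qPoch a p l *
      (1 - p ^ l) * ((p - p ^ l) / p) /
      (qPoch p p l * qPoch (p ^ 2) (p ^ 2) (i + 1) * qPoch a (p ^ 2) (l + i + 1)) := by
    rcases l with _ | l
    · simp [cert]
    · have : (p - p ^ (l + 1)) / p = 1 - p ^ l := by
        field_simp
        ring
      rw [cert, this, Nat.add_sub_cancel, add_assoc (l + 1) i 1]
  rw [hc, term, term, cert, choose_add_two, ← add_assoc l i 1, add_right_comm l 2 i,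
    show l + 2 - 1 = l + 1 by omega]
  simp only [qPoch_succ] at hl hi hA ⊢
  obtain ⟨⟨h1, h2⟩, h3⟩ : (qPoch p p l ≠ 0 ∧ 1 - p * p ^ l ≠ 0) ∧ 1 - p * p ^ (l + 1) ≠ 0 := by
    simpa only [mul_ne_zero_iff] using hl
  obtain ⟨h4, h5⟩ := mul_ne_zero_iff.1 hi
  obtain ⟨⟨h6, h7⟩, h8⟩ : (qPoch a (p ^ 2) (l + i) ≠ 0 ∧ 1 - a * (p ^ 2) ^ (l + i) ≠ 0) ∧
      1 - a * (p ^ 2) ^ (l + i + 1) ≠ 0 := by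
    simpa only [mul_ne_zero_iff] using hA
  generalize qPoch p p l = X1 at *
  generalize qPoch (p ^ 2) (p ^ 2) i = X2 at *
  generalize qPoch a (p ^ 2) (l + i) = X3 at *
  generalize qPoch a p l = X4 at *
  clear hc hl hi hA hp ha
  have hpow : ∀ n, (p ^ 2) ^ n = (p ^ n) ^ 2 := fun n => pow_right_comm p 2 n
  simp only [pow_add, mul_add, pow_mul', hpow, pow_one, mul_one] at *
  clear hpow
  generalize p ^ l = y at *
  generalize p ^ i = w at *
  generalize p ^ (l.choose 2) = c at *
  -- the denominators are opaque while the fractions are cleared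
  generalize hd2 : 1 - p * y = d2 at *
  generalize hd3 : 1 - p * (y * p) = d3 at *
  generalize hd5 : 1 - p ^ 2 * w ^ 2 = d5 at *
  generalize hd7 : 1 - a * (y * w) ^ 2 = d7 at *
  generalize hd8 : 1 - a * (y * w * p) ^ 2 = d8 at *
  field_simp
  subst hd2 hd3 hd5 hd7 hd8
  ring

theorem sum_term {p a : K} (hp0 : p ≠ 0) (hp : ∀ i : ℕ, 0 < i → p ^ i ≠ 1)
    (ha : ∀ n, qPoch a (p ^ 2) n ≠ 0) (r : ℕ) :
    ∑ i ∈ range (r / 2 + 1), term p a (r - 2 * i) i = 1 / qPoch p p r := by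
  induction r using Nat.twoStepInduction with
  | zero =>
    have h1 := ha 1
    simp only [qPoch, prod_range_one, pow_zero, mul_one] at h1
    simp [term, qPoch, h1]
  | one =>
    have h1 := ha 2
    rw [qPoch_succ] at h1
    have h2 : 1 - a ≠ 0 := by simpa [qPoch] using left_ne_zero_of_mul h1
    have h3 : 1 - a * p ^ 2 ≠ 0 := by simpa using right_ne_zero_of_mul h1
    have h4 : 1 - p ≠ 0 := sub_ne_zero.2 fun h => hp 1 one_pos (by simp [← h])
    simp [term, qPoch, prod_range_succ]
    field_simp
  | more r ih _ =>
    have key : ∀ n ≤ r / 2 + 1, (1 - p ^ (r + 2)) * (1 - p ^ (r + 1)) *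
        ∑ i ∈ range (n + 1), term p a (r + 2 - 2 * i) i =
        ∑ i ∈ range n, term p a (r - 2 * i) i + cert p a (r + 2 - 2 * n) n := by
      intro n
      induction n with
      | zero =>
        intro _
        simpa using term_zero ha (r + 2)
      | succ n ihn =>
        intro hn
        obtain ⟨l, rfl⟩ := Nat.exists_eq_add_of_le' (show 2 * n ≤ r by omega)
        have h1 := ihn (by omega)
        have h2 := term_telescope hp0 hp ha l n
        rw [show l + 2 * n + 2 - 2 * n = l + 2 by omega] at h1
        rw [sum_range_succ, mul_add, h1, sum_range_succ _ n,
          show l + 2 * n + 2 - 2 * (n + 1) = l by omega, Nat.add_sub_cancel]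
        linear_combination h2
    have h1 := key (r / 2 + 1) le_rfl
    rw [ih, cert_of_lt_two p a (by omega), add_zero] at h1
    have h2 : (1 : K) - p ^ (r + 2) ≠ 0 := sub_ne_zero.2 (hp _ (by omega)).symm
    have h3 : (1 : K) - p ^ (r + 1) ≠ 0 := sub_ne_zero.2 (hp _ (by omega)).symm
    have h4 := qPoch_self_ne_zero hp r
    rw [show (r + 2) / 2 = r / 2 + 1 by omega, qPoch_succ, qPoch_succ, ← pow_succ', ← pow_succ',
      eq_div_iff (mul_ne_zero (mul_ne_zero h4 h3) h2)]
    rw [eq_div_iff h4] at h1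
    linear_combination h1

/-! ### The coefficients of the shifted factorials in `h` -/

/-- The coefficient `[D + 2 i choose i]_P (1 - P ^ D) / (1 - P ^ (D + 2 i)) P ^ i`, a `q`-analogue
of a ballot number. -/
def ballot (P : K) (D i : ℕ) : K :=
  qBinom P (D + 2 * i) (i : ℤ) * ((1 - P ^ D) / (1 - P ^ (D + 2 * i))) * P ^ i

theorem ballot_eq {P : K} (hP0 : P ≠ 0) (D i : ℕ) :
    ballot P D i = qPoch (P ^ (D + i + 1)) P i / qPoch P P i *
      ((1 - P ^ D) / (1 - P ^ (D + 2 * i))) * P ^ i := by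
  rw [ballot, two_mul, ← add_assoc, qBinom_add hP0]

theorem ballot_eq_sub {P : K} (hP0 : P ≠ 0) (hP : ∀ i : ℕ, 0 < i → P ^ i ≠ 1) {D : ℕ}
    (hD : 0 < D) (i : ℕ) :
    ballot P D i = qBinom P (D + 2 * i - 1) (i : ℤ) - qBinom P (D + 2 * i - 1) ((i : ℤ) - 1) := by
  have h1 : (1 : K) - P ^ (D + 2 * i) ≠ 0 := sub_ne_zero.2 (hP _ (by omega)).symm
  rcases i with _ | i
  · have h2 : qBinom P (D + 2 * 0 - 1) (((0 : ℕ) : ℤ) - 1) = 0 := rfl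
    rw [h2, ballot]
    simp only [mul_zero, add_zero] at h1
    simp [qBinom_zero, h1]
  · have h2 := qPoch_self_ne_zero hP (i + 1)
    rw [ballot_eq hP0, show D + 2 * (i + 1) - 1 = D + i + (i + 1) by omega, qBinom_add hP0,
      show D + i + (i + 1) = D + i + 1 + i by omega, Nat.cast_succ, add_sub_cancel_right,
      qBinom_add hP0, qPoch_succ_left (P ^ (D + i + 1)), qPoch_succ, ← pow_succ,
      show D + (i + 1) + 1 = D + i + 1 + 1 by omega, qPoch_succ P]
    rw [qPoch_succ] at h2
    obtain ⟨h3, h4⟩ := mul_ne_zero_iff.1 h2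
    generalize qPoch (P ^ (D + i + 1 + 1)) P i = X1
    generalize qPoch P P i = X2 at *
    simp only [pow_add, mul_add, pow_mul', pow_one, mul_one] at h1 h4 ⊢
    generalize P ^ D = x at *
    generalize P ^ i = y at *
    generalize hd1 : 1 - x * (y ^ 2 * P ^ 2) = d1 at *
    generalize hd4 : 1 - P * y = d4 at *
    field_simp
    subst hd1 hd4
    ring

theorem pow_mul_succ_eq (q : K) (l : ℕ) :
    q ^ (l * (l + 1)) = (q ^ 2) ^ l * (q ^ 2) ^ (l.choose 2) := by
  rw [← pow_add, ← pow_mul]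
  congr 1
  induction l with
  | zero => rfl
  | succ l ih =>
    rw [Nat.choose_succ_succ' l 1, Nat.choose_one_right]
    linarith

/-- The closed form of the coefficient of a shifted factorial in the defining equations. -/
theorem sum_ballot_mul_qBinom {q : K} (hq0 : q ≠ 0) (hq : ∀ i : ℕ, 0 < i → q ^ i ≠ 1) {M : ℕ}
    (hM : 0 < M) (r : ℕ) :
    ∑ i ∈ range (r / 2 + 1), q ^ ((r - 2 * i) * (r - 2 * i + 1)) *
        ballot (q ^ 4) (M + (r - 2 * i)) i *
        qBinom (q ^ 2) (2 * M - 1 + (r - 2 * i)) ((r - 2 * i : ℕ) : ℤ) =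
      (q ^ 2) ^ r * qPoch (((q ^ 2) ^ M) ^ 2) ((q ^ 2) ^ 2) r / qPoch (q ^ 2) (q ^ 2) r := by
  have hq4 : q ^ 4 = (q ^ 2) ^ 2 := by ring
  simp only [pow_mul_succ_eq, hq4]
  have hp0 : q ^ 2 ≠ 0 := pow_ne_zero _ hq0
  have hp : ∀ i : ℕ, 0 < i → (q ^ 2) ^ i ≠ 1 := fun i hi => by
    rw [← pow_mul]
    exact hq _ (by omega)
  generalize q ^ 2 = p at *
  have ha : ∀ n, qPoch ((p ^ M) ^ 2) (p ^ 2) n ≠ 0 := fun n => by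
    rw [← pow_mul]
    exact qPoch_pow_ne_zero hp (by omega) 2 n
  rw [← mul_one_div, ← sum_term hp0 hp ha, mul_sum]
  refine sum_congr rfl fun i hi => ?_
  obtain ⟨l, rfl⟩ := Nat.exists_eq_add_of_le' (show 2 * i ≤ r by
    have := mem_range.1 hi
    omega)
  rw [Nat.add_sub_cancel, ballot_eq (pow_ne_zero 2 hp0), qBinom_add hp0, term,
    show 2 * M - 1 + 1 = M * 2 by omega, pow_mul]
  have h1 := ha (l + 2 * i + 1)
  have h2 := h1
  rw [show l + 2 * i + 1 = l + i + 1 + i by omega, qPoch_add] at h2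
  have h3 : qPoch ((p ^ M) ^ 2) (p ^ 2) (l + 2 * i) * (1 - (p ^ M) ^ 2 * (p ^ 2) ^ (l + 2 * i)) =
      qPoch ((p ^ M) ^ 2) (p ^ 2) (l + i + 1) *
        qPoch ((p ^ M) ^ 2 * (p ^ 2) ^ (l + i + 1)) (p ^ 2) i := by
    rw [← qPoch_succ, ← qPoch_add, show l + 2 * i + 1 = l + i + 1 + i by omega]
  rw [qPoch_succ] at h1
  have h4 := right_ne_zero_of_mul h1
  have h5 := left_ne_zero_of_mul h2
  have h6 := qPoch_self_ne_zero hp l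
  have h7 := qPoch_pow_ne_zero hp two_pos 2 i
  have e1 : (p ^ 2) ^ (M + l + i + 1) = (p ^ M) ^ 2 * (p ^ 2) ^ (l + i + 1) := by ring
  have e2 : (p ^ 2) ^ (M + l + 2 * i) = (p ^ M) ^ 2 * (p ^ 2) ^ (l + 2 * i) := by ring
  have e3 : (p ^ 2) ^ (M + l) = (p ^ M) ^ 2 * p ^ (2 * l) := by ring
  have e4 : p ^ (l + 2 * i) = p ^ l * (p ^ 2) ^ i := by ring
  rw [e1, e2, e3, e4]
  generalize qPoch ((p ^ M) ^ 2 * (p ^ 2) ^ (l + i + 1)) (p ^ 2) i = X1 at *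
  generalize qPoch ((p ^ M) ^ 2) (p ^ 2) (l + i + 1) = X2 at *
  generalize qPoch ((p ^ M) ^ 2) (p ^ 2) (l + 2 * i) = X3 at *
  generalize (1 - (p ^ M) ^ 2 * (p ^ 2) ^ (l + 2 * i)) = X4 at *
  generalize (1 - (p ^ M) ^ 2 * p ^ (2 * l)) = X5 at *
  generalize (p ^ 2) ^ i = X6 at *
  generalize qPoch (p ^ 2) (p ^ 2) i = X7 at *
  generalize p ^ l = X8 at *
  field_simp
  linear_combination (-(X8 * X5 * X6 * qPoch ((p ^ M) ^ 2) p l)) * h3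

/-! ### The defining equations -/

/-- Regrouping of the double sum in the `k`-th equation: `r` is the distance from `k` to the length
`j - 2 i` of the shifted factorial. -/
theorem sum_range_regroup (F : ℕ → ℕ → K) (k : ℕ) :
    ∑ j ∈ range (k + 1), ∑ i ∈ range (j / 2 + 1), F j i =
      ∑ r ∈ range (k + 1), ∑ i ∈ range (r / 2 + 1), F (k - r + 2 * i) i := by
  rw [sum_sigma', sum_sigma']
  refine sum_bij' (fun x _ => ⟨k - x.1 + 2 * x.2, x.2⟩) (fun x _ => ⟨k - x.1 + 2 * x.2, x.2⟩)
    ?_ ?_ ?_ ?_ ?_ <;> rintro ⟨x, i⟩ hx <;> simp only [mem_sigma, mem_range] at hx ⊢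
  · omega
  · omega
  · simp only [Sigma.mk.injEq, heq_eq_eq, and_true]
    omega
  · simp only [Sigma.mk.injEq, heq_eq_eq, and_true]
    omega
  · congr 1
    omega

/-- The proposed values of `h` solve the defining equations. -/
theorem og_eq_sum {q : K} (hq0 : q ≠ 0) (hq : ∀ i : ℕ, 0 < i → q ^ i ≠ 1) {n k : ℕ}
    (hk : k < n) :
    og q n k = ∑ j ∈ range (k + 1), q ^ ((k - j) * (k - j + 1)) *
      (∑ i ∈ range (j / 2 + 1),
        qPoch (-q ^ (2 * n - 2)) ((q ^ 2)⁻¹) (j - 2 * i) * ballot (q ^ 4) (n - j) i) *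
      qBinom (q ^ 2) (2 * n - 1 - k - j) ((k : ℤ) - (j : ℤ)) := by
  obtain ⟨M, rfl⟩ := Nat.exists_eq_add_of_le' hk.le
  have hM : 0 < M := by omega
  have hp0 : q ^ 2 ≠ 0 := pow_ne_zero _ hq0
  have hp : ∀ i : ℕ, 0 < i → (q ^ 2) ^ i ≠ 1 := fun i hi => by
    rw [← pow_mul]
    exact hq _ (by omega)
  simp only [mul_sum, sum_mul]
  rw [sum_range_regroup]
  have h1 : ∀ r ∈ range (k + 1), ∑ i ∈ range (r / 2 + 1),
      q ^ ((k - (k - r + 2 * i)) * (k - (k - r + 2 * i) + 1)) *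
        (qPoch (-q ^ (2 * (M + k) - 2)) ((q ^ 2)⁻¹) (k - r + 2 * i - 2 * i) *
          ballot (q ^ 4) (M + k - (k - r + 2 * i)) i) *
        qBinom (q ^ 2) (2 * (M + k) - 1 - k - (k - r + 2 * i))
          ((k : ℤ) - ((k - r + 2 * i : ℕ) : ℤ)) =
      qPoch (-(q ^ 2) ^ M) (q ^ 2) k *
        ((q ^ 2) ^ r * qPoch ((q ^ 2) ^ M) (q ^ 2) r / qPoch (q ^ 2) (q ^ 2) r) := by
    intro r hr
    obtain ⟨s, rfl⟩ := Nat.exists_eq_add_of_le (show r ≤ k by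
      have := mem_range.1 hr
      omega)
    -- the shifted factorial of length `s` continues the one of length `r`
    have h2 : qPoch (-q ^ (2 * (M + (r + s)) - 2)) ((q ^ 2)⁻¹) s =
        qPoch (-(q ^ 2) ^ M * (q ^ 2) ^ r) (q ^ 2) s := by
      have h3 := qPoch_inv (-1) hp0 (M + r - 1) s
      rw [neg_one_mul, neg_one_mul, ← pow_mul, show M + r - 1 + 1 = M + r by omega,
        show 2 * (M + r - 1 + s) = 2 * (M + (r + s)) - 2 by omega, pow_add] at h3
      rw [h3, neg_mul]
    have h4 := sum_ballot_mul_qBinom hq0 hq hM r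
    rw [qPoch_sq] at h4
    calc _ = qPoch (-q ^ (2 * (M + (r + s)) - 2)) ((q ^ 2)⁻¹) s *
          ((q ^ 2) ^ r * (qPoch ((q ^ 2) ^ M) (q ^ 2) r * qPoch (-(q ^ 2) ^ M) (q ^ 2) r) /
            qPoch (q ^ 2) (q ^ 2) r) := by
          rw [← h4, mul_sum]
          refine sum_congr rfl fun i hi => ?_
          have hi' := mem_range.1 hi
          rw [show r + s - (r + s - r + 2 * i) = r - 2 * i by omega,
            show r + s - r + 2 * i - 2 * i = s by omega,
            show M + (r + s) - (r + s - r + 2 * i) = M + (r - 2 * i) by omega,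
            show 2 * (M + (r + s)) - 1 - (r + s) - (r + s - r + 2 * i) =
              2 * M - 1 + (r - 2 * i) by omega,
            show ((r + s : ℕ) : ℤ) - ((r + s - r + 2 * i : ℕ) : ℤ) = ((r - 2 * i : ℕ) : ℤ) by
              omega]
          ring
      _ = _ := by
          rw [h2, qPoch_add]
          ring
  rw [sum_congr rfl h1, ← mul_sum, sum_qPoch_div hp, og, Nat.add_sub_cancel,
    show q ^ (4 * M) = ((q ^ 2) ^ M) ^ 2 by ring, show q ^ 4 = (q ^ 2) ^ 2 by ring, qPoch_sq,
    pow_mul, pow_mul]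
  have h5 : (1 : K) - (q ^ 2) ^ M ≠ 0 := sub_ne_zero.2 (hp M hM).symm
  have h6 := qPoch_self_ne_zero hp k
  have h7 := qPoch_succ_left ((q ^ 2) ^ M) (q ^ 2) k
  rw [qPoch_succ, ← pow_add] at h7
  rw [div_mul_div_comm, mul_div_assoc', div_eq_div_iff (mul_ne_zero h6 h5) h6]
  linear_combination qPoch (-(q ^ 2) ^ M) (q ^ 2) k * qPoch (q ^ 2) (q ^ 2) k * h7

end OrthGrass

theorem theoremA4 {K : Type*} [Field K] (q : K) (hq0 : q ≠ 0)
    (hq : ∀ i : ℕ, 0 < i → q ^ i ≠ 1) (n m : ℕ) (hn : 1 ≤ n) (hm : m ≤ n - 1) :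
    OrthGrass.h q n m =
        ∑ k ∈ Finset.range (m / 2 + 1),
          OrthGrass.qPoch (-q ^ (2 * n - 2)) ((q ^ 2)⁻¹) (m - 2 * k) *
            OrthGrass.qBinom (q ^ 4) (n - m + 2 * k) (k : ℤ) *
            ((1 - q ^ (4 * (n - m))) / (1 - q ^ (4 * (n - m + 2 * k)))) * q ^ (4 * k) ∧
      OrthGrass.h q n m =
        ∑ k ∈ Finset.range (m / 2 + 1),
          OrthGrass.qPoch (-q ^ (2 * n - 2)) ((q ^ 2)⁻¹) (m - 2 * k) *
            (OrthGrass.qBinom (q ^ 4) (n - m + 2 * k - 1) (k : ℤ) -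
              OrthGrass.qBinom (q ^ 4) (n - m + 2 * k - 1) ((k : ℤ) - 1)) := by
  have h1 := OrthGrass.eq_h_of_og_eq_sum q n _ (fun k hk => OrthGrass.og_eq_sum hq0 hq hk) m
    (by omega)
  have hP : ∀ i : ℕ, 0 < i → (q ^ 4) ^ i ≠ 1 := fun i hi => by
    rw [← pow_mul]
    exact hq _ (by omega)
  rw [← h1]
  constructor
  · refine Finset.sum_congr rfl fun k _ => ?_
    rw [OrthGrass.ballot, pow_mul, pow_mul, pow_mul]
    ring
  · refine Finset.sum_congr rfl fun k _ => ?_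
    rw [OrthGrass.ballot_eq_sub (pow_ne_zero 4 hq0) hP (by omega)]
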